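/- Let $M$ be a bounded, connected, embedded complex submanifold of $\mathbb{C}^d$, let $\mathsf{k}_M$ be its Kobayashi distance and $\kappa_M$ its Kobayashi--Royden metric, and put $\partial M=\overline{M}\setminus M$. A real Kobayashi geodesic in $M$ is a map $\sigma:I\to M$ on an interval $I\subset\mathbb{R}$ with $\mathsf{k}_M(\sigma(s),\sigma(t))=|s-t|$ for all $s,t\in I$. For $\lambda\ge 1$ and $\kappa\ge 0$, a $(\lambda,\kappa)$-almost-geodesic in $M$ is an absolutely continuous curve $\sigma:I\to M$ such that $\frac1\lambda|t-s|-\kappa\le \mathsf{k}_M(\sigma(t),\sigma(s))\le\lambda|t-s|+\kappa$ for all $s,t\in I$ and $\kappa_M(\sigma(t),\sigma'(t))\le\lambda$ for almost every $t\in I$. A class $\mathcal{C}$ of curves in $M$ is said to satisfy $(\ast)$ if for every pair of points $p\ne q$ in $\partial M$ there are $\mathbb{C}^d$-neighbourhoods $V$ of $p$ and $W$ of $q$ with $\overline V\cap\overline W=\emptyset$ and a compact set $K\subset M$ such that every curve in $\mathcal{C}$ with initial point in $V$ and terminal point in $W$ intersects $K$. The submanifold $M$ is a BZ-visibility submanifold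 if, for every $\lambda\ge1$ and every $\kappa>0$, any two distinct points of $M$ can be joined by a $(\lambda,\kappa)$-almost-geodesic and the $(\lambda,\kappa)$-almost-geodesics in $M$ satisfy $(\ast)$. It is a BNT-visibility submanifold if $(M,\mathsf{k}_M)$ is complete and the real Kobayashi geodesics in $M$ satisfy $(\ast)$. Suppose that $(M,\mathsf{k}_M)$ is a complete Gromov hyperbolic distance space, i.e. it is complete and there is a $\delta$ such that each side of every geodesic triangle in $(M,\mathsf{k}_M)$ lies in the $\delta$-neighbourhood of the union of the other two sides. Then $M$ is a BZ-visibility submanifold if and only if it is a BNT-visibility submanifold. -/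

import Mathlib

open Set Filter Topology MeasureTheory
open scoped ENNReal

/-- The Hermitian space `ℂ^d`, with its Euclidean norm. -/
abbrev CSpace (d : ℕ) : Type := EuclideanSpace ℂ (Fin d)

/-- `M ⊆ ℂ^d` is an embedded complex submanifold: around each of its points there is a biholomorphic
map `Φ` between open subsets of `ℂ^d` that straightens `M` to a complex linear subspace. -/
def IsEmbeddedComplexSubmanifold {d : ℕ} (M : Set (CSpace d)) : Prop :=
  ∀ p ∈ M, ∃ (Φ : OpenPartialHomeomorph (CSpace d) (CSpace d)) (L : Submodule ℂ (CSpace d)),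
    p ∈ Φ.source ∧ DifferentiableOn ℂ Φ Φ.source ∧ DifferentiableOn ℂ Φ.symm Φ.target ∧
      ∀ z ∈ Φ.source, z ∈ M ↔ Φ z ∈ L

/-- The boundary `∂M = closure M \ M` of a submanifold `M` of `ℂ^d`. -/
def submanifoldBoundary {d : ℕ} (M : Set (CSpace d)) : Set (CSpace d) :=
  closure M \ M

/-- `f` restricts to a holomorphic map from the open unit disc into `M`. -/
def IsHolomorphicDisc {d : ℕ} (M : Set (CSpace d)) (f : ℂ → CSpace d) : Prop :=
  DifferentiableOn ℂ f (Metric.ball 0 1) ∧ MapsTo f (Metric.ball 0 1) M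

/-- The Poincaré distance of the open unit disc, normalised as the integrated form of
`|dζ| / (1 - |ζ|²)`. -/
noncomputable def poincareDist (a b : ℂ) : ℝ :=
  Real.artanh (‖a - b‖ / ‖1 - (starRingEnd ℂ) b * a‖)

/-- `c` is the length of a chain of holomorphic discs in `M` from `z` to `w`: there are points
`z = p 0, p 1, …, p n = w` such that `p j` and `p (j + 1)` are the images of points `a j` and `b j`
of the unit disc under a holomorphic disc `f j` in `M`, and `c` is the sum of the Poincaré
distances between `a j` and `b j`. -/
def IsDiscChainLength {d : ℕ} (M : Set (CSpace d)) (z w : CSpace d) (c : ℝ) : Prop :=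
  ∃ (n : ℕ) (p : ℕ → CSpace d) (f : ℕ → ℂ → CSpace d) (a b : ℕ → ℂ),
    p 0 = z ∧ p n = w ∧
    (∀ j < n, IsHolomorphicDisc M (f j) ∧ a j ∈ Metric.ball (0 : ℂ) 1 ∧
      b j ∈ Metric.ball (0 : ℂ) 1 ∧ f j (a j) = p j ∧ f j (b j) = p (j + 1)) ∧
    c = ∑ j ∈ Finset.range n, poincareDist (a j) (b j)

/-- The Kobayashi distance `k_M(z, w)` of points of `M`: the infimum of the lengths of chains of
holomorphic discs from `z` to `w`. -/
noncomputable def kobayashiDist {d : ℕ} (M : Set (CSpace d)) (z w : CSpace d) : ℝ :=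
  sInf {c : ℝ | IsDiscChainLength M z w c}

/-- The Kobayashi–Royden metric `κ_M(z; X)` at a point `z` of `M`: the infimum of `|α|` over all
`α ∈ ℂ` and all holomorphic discs `f` in `M` with `f 0 = z` and `α f'(0) = X`. It is finite on
vectors tangent to `M`, and `∞` on the others. -/
noncomputable def kobayashiRoyden {d : ℕ} (M : Set (CSpace d)) (z X : CSpace d) : ℝ≥0∞ :=
  sInf {c : ℝ≥0∞ | ∃ (f : ℂ → CSpace d) (α : ℂ),
    IsHolomorphicDisc M f ∧ f 0 = z ∧ α • deriv f 0 = X ∧ c = ENNReal.ofReal ‖α‖}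

/-- The restriction of `σ` to the compact interval `[a, b]` is a real Kobayashi geodesic in `M`,
that is, an isometry from `[a, b]` to `(M, k_M)`. -/
def IsKobayashiGeodesic {d : ℕ} (M : Set (CSpace d)) (σ : ℝ → CSpace d) (a b : ℝ) : Prop :=
  a ≤ b ∧ MapsTo σ (Icc a b) M ∧
    ∀ s ∈ Icc a b, ∀ t ∈ Icc a b, kobayashiDist M (σ s) (σ t) = |s - t|

/-- The restriction of `σ` to the compact interval `[a, b]` is a `(lam, kap)`-almost-geodesic
in `M`. -/
def IsAlmostGeodesic {d : ℕ} (M : Set (CSpace d)) (lam kap : ℝ) (σ : ℝ → CSpace d)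
    (a b : ℝ) : Prop :=
  a ≤ b ∧ MapsTo σ (Icc a b) M ∧
    (∀ s ∈ Icc a b, ∀ t ∈ Icc a b,
      1 / lam * |t - s| - kap ≤ kobayashiDist M (σ t) (σ s) ∧
        kobayashiDist M (σ t) (σ s) ≤ lam * |t - s| + kap) ∧
    AbsolutelyContinuousOnInterval σ a b ∧
    ∀ᵐ t ∂(volume.restrict (Icc a b)),
      DifferentiableAt ℝ σ t ∧ kobayashiRoyden M (σ t) (deriv σ t) ≤ ENNReal.ofReal lam

/-- The visibility condition for a class `C` of curves in `M`, where `C σ a b` says that the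
restriction of `σ` to `[a, b]` belongs to the class: any two distinct boundary points have
neighbourhoods `V`, `W` in `ℂ^d` with disjoint closures and a compact set `K ⊆ M` that is met by
all curves of the class with initial point in `V` and terminal point in `W`. -/
def HasVisibility {d : ℕ} (M : Set (CSpace d)) (C : (ℝ → CSpace d) → ℝ → ℝ → Prop) : Prop :=
  ∀ p ∈ submanifoldBoundary M, ∀ q ∈ submanifoldBoundary M, p ≠ q →
    ∃ V ∈ 𝓝 p, ∃ W ∈ 𝓝 q, ∃ K : Set (CSpace d),
      closure V ∩ closure W = ∅ ∧ K ⊆ M ∧ IsCompact K ∧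
        ∀ (σ : ℝ → CSpace d) (a b : ℝ), C σ a b → σ a ∈ V → σ b ∈ W → ∃ t ∈ Icc a b, σ t ∈ K

/-- `M` is a `(lam, kap)`-visibility submanifold. -/
def IsAlmostGeodesicVisibility {d : ℕ} (M : Set (CSpace d)) (lam kap : ℝ) : Prop :=
  (∀ x ∈ M, ∀ y ∈ M, x ≠ y →
    ∃ (σ : ℝ → CSpace d) (a b : ℝ), IsAlmostGeodesic M lam kap σ a b ∧ σ a = x ∧ σ b = y) ∧
  HasVisibility M (IsAlmostGeodesic M lam kap)

/-- `M` is a BZ-visibility submanifold. -/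
def IsBZVisibility {d : ℕ} (M : Set (CSpace d)) : Prop :=
  ∀ lam kap : ℝ, 1 ≤ lam → 0 < kap → IsAlmostGeodesicVisibility M lam kap

/-- `(M, k_M)` is complete: every `k_M`-Cauchy sequence in `M` converges, with respect to `k_M`, to
a point of `M`. -/
def IsKobayashiComplete {d : ℕ} (M : Set (CSpace d)) : Prop :=
  ∀ u : ℕ → CSpace d, (∀ n, u n ∈ M) →
    (∀ ε > 0, ∃ N, ∀ m ≥ N, ∀ n ≥ N, kobayashiDist M (u m) (u n) < ε) →
    ∃ x ∈ M, Tendsto (fun n => kobayashiDist M (u n) x) atTop (𝓝 0)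

/-- `M` is a BNT-visibility submanifold. -/
def IsBNTVisibility {d : ℕ} (M : Set (CSpace d)) : Prop :=
  IsKobayashiComplete M ∧ HasVisibility M (IsKobayashiGeodesic M)

/-- `(M, k_M)` (a geodesic space whenever it is complete) is Gromov hyperbolic: for some `δ`, every
side of every geodesic triangle lies in the `δ`-neighbourhood of the union of the other two sides.
The sides run cyclically from `x` to `y`, from `y` to `z` and from `z` to `x`, so that it
suffices to say this of the first one. -/
def IsKobayashiGromovHyperbolic {d : ℕ} (M : Set (CSpace d)) : Prop :=
  ∃ δ : ℝ, ∀ (σ₁ σ₂ σ₃ : ℝ → CSpace d) (a₁ b₁ a₂ b₂ a₃ b₃ : ℝ),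
    IsKobayashiGeodesic M σ₁ a₁ b₁ → IsKobayashiGeodesic M σ₂ a₂ b₂ →
    IsKobayashiGeodesic M σ₃ a₃ b₃ →
    σ₁ b₁ = σ₂ a₂ → σ₂ b₂ = σ₃ a₃ → σ₃ b₃ = σ₁ a₁ →
    ∀ t ∈ Icc a₁ b₁,
      (∃ s ∈ Icc a₂ b₂, kobayashiDist M (σ₁ t) (σ₂ s) ≤ δ) ∨
        ∃ s ∈ Icc a₃ b₃, kobayashiDist M (σ₁ t) (σ₃ s) ≤ δ

/-!
A holomorphic disc can be traversed along a diameter by the hyperbolic tangent with Kobayashi–Royden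
speed at most `1`. Hence chains of discs whose length nearly equals the Kobayashi distance of their
end points give almost-geodesics between any two points, and `(M, k_M)` is a length space. As `M` is
bounded, the Schwarz lemma bounds the Euclidean distance by a multiple of `k_M`, and `k_M` induces
the topology of `M`; so, by Hopf–Rinow, completeness makes `(M, k_M)` proper and geodesic.

In a hyperbolic geodesic space, a geodesic lies within bounded distance of every
`(λ, κ)`-quasi-geodesic with the same end points (Morse lemma), and a `(1, κ)`-quasi-geodesic lies
within bounded distance of every geodesic with the same end points. A compact set that meets the
curves of one class therefore has a compact `k_M`-neighbourhood that meets the curves of the other.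
-/

section Geodesics

variable {X : Type*} [PseudoMetricSpace X] {γ σ : ℝ → X} {a b c e : ℝ} {x y p : X} {S : Set X}
  {δ kap lam : ℝ}

/-- The restriction of `γ` to `[a, b]` is a geodesic, parametrised by arc length. -/
structure IsGeodesic (γ : ℝ → X) (a b : ℝ) : Prop where
  le : a ≤ b
  dist_eq : ∀ s ∈ Icc a b, ∀ t ∈ Icc a b, dist (γ s) (γ t) = |s - t|

/-- `S` is the image of a geodesic from `x` to `y`. -/
def IsGeodesicSegment (x y : X) (S : Set X) : Prop :=
  ∃ (γ : ℝ → X) (a b : ℝ), IsGeodesic γ a b ∧ γ a = x ∧ γ b = y ∧ γ '' Icc a b = S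

/-- Any two points are joined by a geodesic segment. -/
def IsGeodesicSpace (X : Type*) [PseudoMetricSpace X] : Prop :=
  ∀ x y : X, ∃ S, IsGeodesicSegment x y S

/-- Gromov hyperbolicity: every side of a geodesic triangle lies in the closed `δ`-neighbourhood of
the union of the other two. -/
def HasThinTriangles (X : Type*) [PseudoMetricSpace X] (δ : ℝ) : Prop :=
  ∀ ⦃x y z : X⦄ ⦃S T U : Set X⦄, IsGeodesicSegment x y S → IsGeodesicSegment y z T →
    IsGeodesicSegment z x U → ∀ p ∈ S, ∃ q ∈ T ∪ U, dist p q ≤ δ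

/-- The restriction of `σ` to `[a, b]` is a `(lam, kap)`-quasi-geodesic, not necessarily
continuous. -/
structure IsQuasigeodesic (lam kap : ℝ) (σ : ℝ → X) (a b : ℝ) : Prop where
  le : a ≤ b
  le_dist : ∀ s ∈ Icc a b, ∀ t ∈ Icc a b, 1 / lam * |s - t| - kap ≤ dist (σ s) (σ t)
  dist_le : ∀ s ∈ Icc a b, ∀ t ∈ Icc a b, dist (σ s) (σ t) ≤ lam * |s - t| + kap

theorem IsGeodesic.continuousOn (h : IsGeodesic γ a b) : ContinuousOn γ (Icc a b) :=
  (LipschitzOnWith.mk_one fun s hs t ht => (h.dist_eq s hs t ht).le).continuousOn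

theorem IsGeodesic.mono (h : IsGeodesic γ a b) (hac : a ≤ c) (hce : c ≤ e) (heb : e ≤ b) :
    IsGeodesic γ c e :=
  ⟨hce, fun s hs t ht => h.dist_eq s (Icc_subset_Icc hac heb hs) t (Icc_subset_Icc hac heb ht)⟩

theorem IsGeodesic.comp_neg (h : IsGeodesic γ a b) : IsGeodesic (fun t => γ (-t)) (-b) (-a) where
  le := neg_le_neg h.le
  dist_eq s hs t ht := by
    rw [h.dist_eq (-s) ⟨le_neg_of_le_neg hs.2, neg_le_of_neg_le hs.1⟩ (-t)
      ⟨le_neg_of_le_neg ht.2, neg_le_of_neg_le ht.1⟩, ← neg_sub', abs_neg]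

theorem dist_le_abs_sub_of_lipschitzOnWith_one {s : Set ℝ} (h : LipschitzOnWith 1 γ s) {u v : ℝ}
    (hu : u ∈ s) (hv : v ∈ s) : dist (γ u) (γ v) ≤ |u - v| := by
  simpa [Real.dist_eq] using h.dist_le_mul u hu v hv

theorem abs_sub_le_dist_add_of_lipschitzOnWith_one (h : LipschitzOnWith 1 γ (Icc a b))
    (hab : b - a ≤ dist (γ a) (γ b) + kap) :
    ∀ s ∈ Icc a b, ∀ t ∈ Icc a b, |s - t| ≤ dist (γ s) (γ t) + kap := by
  have key : ∀ s ∈ Icc a b, ∀ t ∈ Icc a b, t - s ≤ dist (γ s) (γ t) + kap := by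
    intro s hs t ht
    have hab' : a ≤ b := hs.1.trans hs.2
    have has := dist_le_abs_sub_of_lipschitzOnWith_one h (left_mem_Icc.2 hab') hs
    have htb := dist_le_abs_sub_of_lipschitzOnWith_one h ht (right_mem_Icc.2 hab')
    rw [abs_sub_comm, abs_of_nonneg (sub_nonneg.2 hs.1)] at has
    rw [abs_sub_comm, abs_of_nonneg (sub_nonneg.2 ht.2)] at htb
    linarith [dist_triangle4 (γ a) (γ s) (γ t) (γ b)]
  exact fun s hs t ht =>
    abs_sub_le_iff.2 ⟨dist_comm (γ t) (γ s) ▸ key t ht s hs, key s hs t ht⟩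

theorem isGeodesic_of_lipschitzOnWith_one (hab : a ≤ b) (h : LipschitzOnWith 1 γ (Icc a b))
    (hle : b - a ≤ dist (γ a) (γ b)) : IsGeodesic γ a b where
  le := hab
  dist_eq s hs t ht := le_antisymm (dist_le_abs_sub_of_lipschitzOnWith_one h hs ht) <| by
    rw [← add_zero (dist _ _)] at hle ⊢
    exact abs_sub_le_dist_add_of_lipschitzOnWith_one h hle s hs t ht

namespace IsGeodesicSegment

theorem symm (h : IsGeodesicSegment x y S) : IsGeodesicSegment y x S := by
  obtain ⟨γ, a, b, hγ, rfl, rfl, rfl⟩ := h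
  refine ⟨fun t => γ (-t), -b, -a, hγ.comp_neg, by simp only [neg_neg],
    by simp only [neg_neg], ?_⟩
  rw [← image_image γ, image_neg_Icc, neg_neg, neg_neg]

theorem left_mem (h : IsGeodesicSegment x y S) : x ∈ S := by
  obtain ⟨γ, a, b, hγ, rfl, rfl, rfl⟩ := h
  exact mem_image_of_mem _ (left_mem_Icc.2 hγ.le)

theorem right_mem (h : IsGeodesicSegment x y S) : y ∈ S :=
  h.symm.left_mem

theorem refl (x : X) : IsGeodesicSegment x x {x} :=
  ⟨fun _ => x, 0, 0, ⟨le_rfl, fun s hs t ht => by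
    simp only [Icc_self, mem_singleton_iff] at hs ht
    simp [hs, ht]⟩, rfl, rfl, by simp⟩

theorem dist_add_dist (h : IsGeodesicSegment x y S) (hp : p ∈ S) :
    dist x p + dist p y = dist x y := by
  obtain ⟨γ, a, b, hγ, rfl, rfl, rfl⟩ := h
  obtain ⟨t, ht, rfl⟩ := hp
  have ha := left_mem_Icc.2 hγ.le
  have hb := right_mem_Icc.2 hγ.le
  rw [hγ.dist_eq a ha t ht, hγ.dist_eq t ht b hb, hγ.dist_eq a ha b hb,
    abs_of_nonpos (sub_nonpos.2 ht.1), abs_of_nonpos (sub_nonpos.2 ht.2),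
    abs_of_nonpos (sub_nonpos.2 hγ.le)]
  ring

theorem isCompact (h : IsGeodesicSegment x y S) : IsCompact S := by
  obtain ⟨γ, a, b, hγ, rfl, rfl, rfl⟩ := h
  exact isCompact_Icc.image_of_continuousOn hγ.continuousOn

theorem isPreconnected (h : IsGeodesicSegment x y S) : IsPreconnected S := by
  obtain ⟨γ, a, b, hγ, rfl, rfl, rfl⟩ := h
  exact isPreconnected_Icc.image _ hγ.continuousOn

theorem exists_subsegment (h : IsGeodesicSegment x y S) (hp : p ∈ S) {r : ℝ} (hr : 0 ≤ r) :
    ∃ u ∈ S, ∃ v ∈ S, ∃ T, IsGeodesicSegment u v T ∧ p ∈ T ∧ dist p u ≤ r ∧ dist p v ≤ r ∧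
      (u = x ∨ dist p u = r) ∧ (v = y ∨ dist p v = r) := by
  obtain ⟨γ, a, b, hγ, rfl, rfl, rfl⟩ := h
  obtain ⟨t, ht, rfl⟩ := hp
  have hu : max a (t - r) ∈ Icc a b := ⟨le_max_left _ _, max_le hγ.le (by linarith [ht.2])⟩
  have hv : min b (t + r) ∈ Icc a b := ⟨le_min hγ.le (by linarith [ht.1]), min_le_left _ _⟩
  have hut : max a (t - r) ≤ t := max_le ht.1 (by linarith)
  have htv : t ≤ min b (t + r) := le_min ht.2 (by linarith)
  have hdu : dist (γ t) (γ (max a (t - r))) = t - max a (t - r) := by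
    rw [hγ.dist_eq _ ht _ hu, abs_of_nonneg (sub_nonneg.2 hut)]
  have hdv : dist (γ t) (γ (min b (t + r))) = min b (t + r) - t := by
    rw [hγ.dist_eq _ ht _ hv, abs_sub_comm, abs_of_nonneg (sub_nonneg.2 htv)]
  refine ⟨_, mem_image_of_mem γ hu, _, mem_image_of_mem γ hv, _,
    ⟨γ, _, _, hγ.mono hu.1 (hut.trans htv) hv.2, rfl, rfl, rfl⟩,
    mem_image_of_mem γ ⟨hut, htv⟩, ?_, ?_, ?_, ?_⟩
  · linarith [le_max_right a (t - r)]
  · linarith [min_le_right b (t + r)]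
  · rcases max_choice a (t - r) with h | h
    · exact Or.inl (by rw [h])
    · exact Or.inr (by rw [hdu, h]; ring)
  · rcases min_choice b (t + r) with h | h
    · exact Or.inl (by rw [h])
    · exact Or.inr (by rw [hdv, h]; ring)

end IsGeodesicSegment

theorem HasThinTriangles.nonneg (hX : HasThinTriangles X δ) (x : X) : 0 ≤ δ := by
  have hx := IsGeodesicSegment.refl x
  obtain ⟨q, -, hq⟩ := hX hx hx hx x (mem_singleton x)
  exact dist_nonneg.trans hq

theorem HasThinTriangles.exists_near_of_quadrilateral (hX : HasThinTriangles X δ)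
    (hgeo : IsGeodesicSpace X) {z w : X} {T U V : Set X} (hS : IsGeodesicSegment x y S)
    (hT : IsGeodesicSegment y z T) (hU : IsGeodesicSegment z w U) (hV : IsGeodesicSegment w x V)
    (hp : p ∈ S) : ∃ q ∈ T ∪ U ∪ V, dist p q ≤ 2 * δ := by
  obtain ⟨E, hE⟩ := hgeo z x
  obtain ⟨q, hq | hq, hpq⟩ := hX hS hT hE p hp
  · exact ⟨q, Or.inl (Or.inl hq), by linarith [hX.nonneg p]⟩
  · obtain ⟨q', hq', hqq'⟩ := hX hE hV.symm hU.symm q hq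
    refine ⟨q', ?_, by linarith [dist_triangle p q q']⟩
    rcases hq' with hq' | hq'
    exacts [Or.inr hq', Or.inl (Or.inr hq')]

theorem HasThinTriangles.exists_near_of_dist_add_dist_le (hX : HasThinTriangles X δ)
    (hgeo : IsGeodesicSpace X) (hS : IsGeodesicSegment x y S)
    (hp : dist x p + dist p y ≤ dist x y + c) : ∃ q ∈ S, dist p q ≤ 3 * δ + c := by
  obtain ⟨T, hT⟩ := hgeo x p
  obtain ⟨U, hU⟩ := hgeo p y
  have hδ := hX.nonneg p
  have hcover : S ⊆ Metric.cthickening δ T ∪ Metric.cthickening δ U := by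
    intro q hq
    obtain ⟨z, hz | hz, hqz⟩ := hX hS.symm hT hU q hq
    · exact Or.inl (Metric.mem_cthickening_of_dist_le _ _ _ _ hz hqz)
    · exact Or.inr (Metric.mem_cthickening_of_dist_le _ _ _ _ hz hqz)
  obtain ⟨q, hqS, hqT, hqU⟩ := isPreconnected_closed_iff.1 hS.isPreconnected _ _
    Metric.isClosed_cthickening Metric.isClosed_cthickening hcover
    ⟨x, hS.left_mem, Metric.self_subset_cthickening _ hT.left_mem⟩
    ⟨y, hS.right_mem, Metric.self_subset_cthickening _ hU.right_mem⟩
  rw [hT.isCompact.cthickening_eq_biUnion_closedBall hδ, mem_iUnion₂] at hqT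
  rw [hU.isCompact.cthickening_eq_biUnion_closedBall hδ, mem_iUnion₂] at hqU
  obtain ⟨u, hu, hqu⟩ := hqT
  obtain ⟨v, hv, hqv⟩ := hqU
  rw [Metric.mem_closedBall] at hqu hqv
  refine ⟨q, hqS, ?_⟩
  have hup : dist u p ≤ 2 * δ + c := by
    linarith [hT.dist_add_dist hu, hU.dist_add_dist hv, dist_triangle4 x u v y,
      dist_triangle_left u v q, dist_nonneg (x := p) (y := v)]
  linarith [dist_triangle_left p q u, dist_comm q u]

end Geodesics

section Morse

variable {X : Type*} [PseudoMetricSpace X] {σ : ℝ → X} {a b c : ℝ} {x p : X} {S O : Set X}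
  {δ kap lam : ℝ}

theorem HasThinTriangles.exists_near_of_dist_le_two_pow (hX : HasThinTriangles X δ)
    (hgeo : IsGeodesicSpace X) {E : Type*} [SeminormedAddCommGroup E] [NormedSpace ℝ E] {s : Set E}
    (hs : Convex ℝ s) {f : E → X}
    (hf : ∀ u ∈ s, ∀ v ∈ s, dist u v ≤ 1 → dist (f u) (f v) ≤ c) (k : ℕ) :
    ∀ u ∈ s, ∀ v ∈ s, dist u v ≤ 2 ^ k → ∀ S, IsGeodesicSegment (f u) (f v) S →
      ∀ p ∈ S, ∃ w ∈ s, dist p (f w) ≤ k * δ + c := by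
  induction k with
  | zero =>
    intro u hu v hv huv S hS p hp
    rw [pow_zero] at huv
    refine ⟨u, hu, ?_⟩
    rw [Nat.cast_zero, zero_mul, zero_add, dist_comm]
    linarith [hf u hu v hv huv, hS.dist_add_dist hp, dist_nonneg (x := p) (y := f v)]
  | succ k ih =>
    intro u hu v hv huv S hS p hp
    have hm : midpoint ℝ u v ∈ s := hs.midpoint_mem hu hv
    have hhalf : (2 : ℝ)⁻¹ * dist u v ≤ 2 ^ k := by
      rw [pow_succ] at huv
      linarith
    have hum : dist u (midpoint ℝ u v) ≤ 2 ^ k := by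
      rwa [dist_left_midpoint, Real.norm_ofNat]
    have hmv : dist (midpoint ℝ u v) v ≤ 2 ^ k := by
      rwa [dist_midpoint_right, Real.norm_ofNat]
    obtain ⟨T, hT⟩ := hgeo (f (midpoint ℝ u v)) (f v)
    obtain ⟨U, hU⟩ := hgeo (f u) (f (midpoint ℝ u v))
    obtain ⟨q, hq, hpq⟩ := hX hS hT.symm hU.symm p hp
    obtain ⟨w, hw, hqw⟩ : ∃ w ∈ s, dist q (f w) ≤ k * δ + c := by
      rcases hq with hq | hq
      exacts [ih _ hm _ hv hmv T hT q hq, ih _ hu _ hm hum U hU q hq]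
    refine ⟨w, hw, ?_⟩
    push_cast
    linarith [dist_triangle p q (f w)]

theorem exists_forall_le_of_two_pow_le (A B : ℝ) :
    ∃ N : ℕ, ∀ k : ℕ, (2 : ℝ) ^ k ≤ A * k + B → k ≤ N := by
  have hlin : (fun k : ℕ => A * (k : ℝ) + B) =o[atTop] fun k : ℕ => (2 : ℝ) ^ k :=
    ((isLittleO_coe_const_pow_of_one_lt one_lt_two).const_mul_left A).add
      (Asymptotics.isLittleO_const_left.2 (Or.inr
        (tendsto_norm_atTop_atTop.comp (tendsto_pow_atTop_atTop_of_one_lt one_lt_two))))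
  obtain ⟨N, hN⟩ := eventually_atTop.1 (hlin.bound one_half_pos)
  refine ⟨N, fun k hk => le_of_not_gt fun hNk => ?_⟩
  have hbound := (le_abs_self _).trans (hN k hNk.le)
  rw [Real.norm_of_nonneg (by positivity)] at hbound
  linarith [pow_pos (zero_lt_two' ℝ) k]

/-- The condition on `q` holds at the points of a geodesic from `w` to `o`. -/
theorem exists_mem_forall_infDist_le_dist (hO : O.Nonempty) {w : X}
    (hw : Metric.infDist w O ≤ Metric.infDist x O)
    (hxw : w ∈ O ∨ dist x w = 2 * (Metric.infDist x O + 1)) :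
    ∃ o ∈ O, dist w o ≤ Metric.infDist x O + 1 ∧
      ∀ q, dist w q + dist q o = dist w o → Metric.infDist x O ≤ dist x q := by
  rcases hxw with hwO | hxw
  · refine ⟨w, hwO, ?_, fun q hq => ?_⟩
    · rw [dist_self]
      linarith [Metric.infDist_nonneg (x := x) (s := O)]
    · rw [dist_self] at hq
      linarith [Metric.infDist_le_dist_of_mem hwO (x := x), dist_triangle x q w,
        dist_nonneg (x := w) (y := q), dist_comm w q]
  · obtain ⟨o, hoO, ho⟩ := (Metric.infDist_lt_iff hO).1 (hw.trans_lt (lt_add_one _))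
    refine ⟨o, hoO, ho.le, fun q hq => ?_⟩
    linarith [dist_triangle x q w, dist_comm w q, dist_nonneg (x := q) (y := o)]

theorem IsQuasigeodesic.abs_sub_le (hσ : IsQuasigeodesic lam kap σ a b) (hlam : 0 < lam) {s t : ℝ}
    (hs : s ∈ Icc a b) (ht : t ∈ Icc a b) : |s - t| ≤ lam * (dist (σ s) (σ t) + kap) := by
  have h := hσ.le_dist s hs t ht
  rw [tsub_le_iff_right, one_div, inv_mul_le_iff₀ hlam] at h
  exact h

theorem IsQuasigeodesic.dist_le_add_of_dist_le_one (hσ : IsQuasigeodesic lam kap σ a b)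
    (hlam : 0 ≤ lam) :
    ∀ s ∈ Icc a b, ∀ t ∈ Icc a b, dist s t ≤ 1 → dist (σ s) (σ t) ≤ lam + kap := by
  intro s hs t ht hst
  refine (hσ.dist_le s hs t ht).trans ?_
  gcongr
  exact mul_le_of_le_one_right hlam hst

theorem IsQuasigeodesic.dist_add_dist_le (hσ : IsQuasigeodesic 1 kap σ a b) {t : ℝ}
    (ht : t ∈ Icc a b) : dist (σ a) (σ t) + dist (σ t) (σ b) ≤ dist (σ a) (σ b) + 3 * kap := by
  have ha := left_mem_Icc.2 hσ.le
  have hb := right_mem_Icc.2 hσ.le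
  have hat := hσ.dist_le a ha t ht
  have htb := hσ.dist_le t ht b hb
  have hab := hσ.le_dist a ha b hb
  rw [abs_sub_comm, abs_of_nonneg (sub_nonneg.2 ht.1)] at hat
  rw [abs_sub_comm, abs_of_nonneg (sub_nonneg.2 ht.2)] at htb
  rw [abs_sub_comm, abs_of_nonneg (sub_nonneg.2 hσ.le)] at hab
  linarith

/-- Let `D` be the largest distance of a point of `S` to the quasi-geodesic. The points of `S` at
distance `2 * (D + 1)` from `x` are joined through the quasi-geodesic by a path whose outer legs
stay at distance `D` from `x` and whose middle piece has parameter length linear in `D`. Bisecting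
that piece `k` times, with `2 ^ k` comparable to `D`, bounds `D` linearly in `k`. -/
theorem HasThinTriangles.infDist_image_le_of_isMaxOn (hX : HasThinTriangles X δ)
    (hgeo : IsGeodesicSpace X) (hlam : 0 < lam) (hσ : IsQuasigeodesic lam kap σ a b)
    (hS : IsGeodesicSegment (σ a) (σ b) S) (hxS : x ∈ S)
    (hmax : IsMaxOn (Metric.infDist · (σ '' Icc a b)) S x) :
    ∃ k : ℕ, (2 : ℝ) ^ k ≤ 2 * (lam * (6 * (Metric.infDist x (σ '' Icc a b) + 1) + kap) + 1) ∧
      Metric.infDist x (σ '' Icc a b) ≤ (k + 2) * δ + (lam + kap) := by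
  set O := σ '' Icc a b
  set D := Metric.infDist x O
  have hδ := hX.nonneg x
  have haO : σ a ∈ O := mem_image_of_mem σ (left_mem_Icc.2 hσ.le)
  have hbO : σ b ∈ O := mem_image_of_mem σ (right_mem_Icc.2 hσ.le)
  have hD : 0 ≤ D := Metric.infDist_nonneg
  obtain ⟨u, huS, v, hvS, T, hT, hxT, hxu, hxv, hu, hv⟩ :=
    hS.exists_subsegment hxS (r := 2 * (D + 1)) (by linarith)
  obtain ⟨_, ⟨t₁, ht₁, rfl⟩, (hut : _ ≤ D + 1), (hu' : ∀ q, _ → D ≤ _)⟩ :=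
    exists_mem_forall_infDist_le_dist ⟨_, haO⟩ (hmax huS) (hu.imp_left fun h : u = _ => h ▸ haO)
  obtain ⟨_, ⟨t₂, ht₂, rfl⟩, (hvt : _ ≤ D + 1), (hv' : ∀ q, _ → D ≤ _)⟩ :=
    exists_mem_forall_infDist_le_dist ⟨_, haO⟩ (hmax hvS) (hv.imp_left fun h : v = _ => h ▸ hbO)
  have hlen : |t₁ - t₂| ≤ lam * (6 * (D + 1) + kap) := by
    refine (hσ.abs_sub_le hlam ht₁ ht₂).trans ?_
    gcongr
    linarith [dist_triangle4_left u v (σ t₁) (σ t₂), dist_triangle_left u v x]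
  obtain ⟨k, hk, hk'⟩ := exists_nat_pow_near (show 1 ≤ |t₁ - t₂| + 1 by simp) one_lt_two
  refine ⟨k + 1, by rw [pow_succ]; linarith, ?_⟩
  have hunit := hσ.dist_le_add_of_dist_le_one hlam.le
  have hc : 0 ≤ lam + kap := dist_nonneg.trans (hunit t₁ ht₁ t₁ ht₁ (by simp))
  obtain ⟨U, hU⟩ := hgeo v (σ t₂)
  obtain ⟨V, hV⟩ := hgeo (σ t₁) (σ t₂)
  obtain ⟨W, hW⟩ := hgeo u (σ t₁)
  have hkδ : 0 ≤ k * δ := by positivity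
  push_cast
  obtain ⟨q, (hq | hq) | hq, hxq⟩ := hX.exists_near_of_quadrilateral hgeo hT hU hV.symm hW.symm hxT
  · linarith [hv' q (hU.dist_add_dist hq)]
  · obtain ⟨w, hw, hqw⟩ := hX.exists_near_of_dist_le_two_pow hgeo (convex_Icc a b) hunit (k + 1)
      t₁ ht₁ t₂ ht₂ (by rw [Real.dist_eq]; linarith) V hV q hq
    push_cast at hqw
    linarith [dist_triangle x q (σ w),
      Metric.infDist_le_dist_of_mem (x := x) (mem_image_of_mem σ hw)]
  · linarith [hu' q (hW.dist_add_dist hq)]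

theorem HasThinTriangles.exists_quasigeodesic_near (hX : HasThinTriangles X δ)
    (hgeo : IsGeodesicSpace X) (hlam : 0 < lam) (kap : ℝ) :
    ∃ R, ∀ (σ : ℝ → X) (a b : ℝ), IsQuasigeodesic lam kap σ a b →
      ∀ S, IsGeodesicSegment (σ a) (σ b) S → ∀ p ∈ S, ∃ t ∈ Icc a b, dist p (σ t) ≤ R := by
  obtain ⟨N, hN⟩ := exists_forall_le_of_two_pow_le (2 * (lam * 6 * δ))
    (2 * (lam * (6 * (2 * δ + (lam + kap) + 1) + kap) + 1))
  refine ⟨(N + 2) * δ + (lam + kap) + 1, fun σ a b hσ S hS p hp => ?_⟩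
  obtain ⟨x, hxS, hmax⟩ := hS.isCompact.exists_isMaxOn ⟨p, hp⟩
    (Metric.continuous_infDist_pt (σ '' Icc a b)).continuousOn
  obtain ⟨k, hk, hD⟩ := hX.infDist_image_le_of_isMaxOn hgeo hlam hσ hS hxS hmax
  have hkN : (k : ℝ) ≤ N := by
    refine mod_cast hN k (hk.trans ?_)
    calc _ ≤ 2 * (lam * (6 * ((k + 2) * δ + (lam + kap) + 1) + kap) + 1) := by gcongr
      _ = _ := by ring
  have hδ := hX.nonneg p
  have hlt : Metric.infDist p (σ '' Icc a b) < (N + 2) * δ + (lam + kap) + 1 :=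
    calc _ ≤ Metric.infDist x (σ '' Icc a b) := hmax hp
      _ ≤ (N + 2) * δ + (lam + kap) := hD.trans (by gcongr)
      _ < _ := lt_add_one _
  obtain ⟨_, ⟨t, ht, rfl⟩, hpt⟩ :=
    (Metric.infDist_lt_iff ⟨_, mem_image_of_mem σ (left_mem_Icc.2 hσ.le)⟩).1 hlt
  exact ⟨t, ht, hpt.le⟩

end Morse

section HopfRinow

variable {X : Type*}

/-- Any two points are joined by curves of length arbitrarily close to their distance, parametrised
on `[0, l]` with speed at most `1`. -/
def IsLengthSpace (X : Type*) [PseudoMetricSpace X] : Prop :=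
  ∀ (x y : X) (ε : ℝ), 0 < ε → ∃ (σ : ℝ → X) (l : ℝ),
    0 ≤ l ∧ l ≤ dist x y + ε ∧ σ 0 = x ∧ σ l = y ∧ LipschitzOnWith 1 σ (Icc 0 l)

section Proper

variable [PseudoMetricSpace X]

theorem IsLengthSpace.closedBall_subset_thickening (hX : IsLengthSpace X) (p : X) {r r' ε : ℝ}
    (hr : 0 ≤ r) (hε : 0 < ε) (hr' : r' < r + ε) :
    Metric.closedBall p r' ⊆ Metric.thickening ε (Metric.closedBall p r) := by
  intro y hy
  rw [Metric.mem_closedBall'] at hy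
  rw [Metric.mem_thickening_iff]
  obtain ⟨σ, l, hl, hlε, rfl, rfl, hσ⟩ := hX p y ((r + ε - r') / 2) (by linarith)
  have h0 := left_mem_Icc.2 hl
  rcases le_or_gt l r with hlr | hrl
  · have hd := dist_le_abs_sub_of_lipschitzOnWith_one hσ (right_mem_Icc.2 hl) h0
    rw [sub_zero, abs_of_nonneg hl] at hd
    exact ⟨σ l, hd.trans hlr, by rwa [dist_self]⟩
  · have hrI : r ∈ Icc 0 l := ⟨hr, hrl.le⟩
    have hd := dist_le_abs_sub_of_lipschitzOnWith_one hσ hrI h0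
    have hd' := dist_le_abs_sub_of_lipschitzOnWith_one hσ (right_mem_Icc.2 hl) hrI
    rw [sub_zero, abs_of_nonneg hr] at hd
    rw [abs_of_pos (sub_pos.2 hrl)] at hd'
    exact ⟨σ r, hd, by linarith⟩

theorem IsLengthSpace.isCompact_closedBall_of_forall_lt [CompleteSpace X] (hX : IsLengthSpace X)
    (p : X) {R : ℝ} (hR : 0 < R) (h : ∀ r < R, IsCompact (Metric.closedBall p r)) :
    IsCompact (Metric.closedBall p R) := by
  refine TotallyBounded.isCompact_of_isClosed (Metric.totallyBounded_iff.2 fun ε hε => ?_)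
    Metric.isClosed_closedBall
  have hc := h (max 0 (R - ε / 4)) (max_lt hR (by linarith))
  obtain ⟨t, ht, hcov⟩ := Metric.totallyBounded_iff.1 hc.totallyBounded (ε / 2) (half_pos hε)
  refine ⟨t, ht, fun y hy => ?_⟩
  obtain ⟨m, hm, hym⟩ := Metric.mem_thickening_iff.1 <|
    hX.closedBall_subset_thickening p (le_max_left 0 (R - ε / 4)) (half_pos hε)
      (by linarith [le_max_right 0 (R - ε / 4)]) hy
  obtain ⟨c, hct, hmc⟩ := mem_iUnion₂.1 (hcov hm)
  rw [Metric.mem_ball] at hmc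
  exact mem_iUnion₂.2 ⟨c, hct, by rw [Metric.mem_ball]; linarith [dist_triangle y m c]⟩

theorem IsLengthSpace.exists_lt_isCompact_closedBall [LocallyCompactSpace X]
    (hX : IsLengthSpace X) {p : X} {r : ℝ} (hr : 0 ≤ r) (h : IsCompact (Metric.closedBall p r)) :
    ∃ r' > r, IsCompact (Metric.closedBall p r') := by
  obtain ⟨ε, hε, hK⟩ := h.exists_isCompact_cthickening
  exact ⟨r + ε / 2, by linarith, hK.of_isClosed_subset Metric.isClosed_closedBall <|
    (hX.closedBall_subset_thickening p hr hε (by linarith)).trans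
      (Metric.thickening_subset_cthickening _ _)⟩

theorem IsLengthSpace.properSpace [CompleteSpace X] [LocallyCompactSpace X]
    (hX : IsLengthSpace X) : ProperSpace X := by
  refine ⟨fun p r₀ => by_contra fun hr₀ => ?_⟩
  set A : Set ℝ := {r | IsCompact (Metric.closedBall p r)}
  have hdown : ∀ r ∈ A, ∀ r' ≤ r, r' ∈ A := fun r hr r' hr' =>
    IsCompact.of_isClosed_subset hr Metric.isClosed_closedBall
      (Metric.closedBall_subset_closedBall hr')
  have hzero : (0 : ℝ) ∈ A := by
    change IsCompact (Metric.closedBall p 0)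
    rw [Metric.closedBall_zero']
    exact isCompact_singleton.closure
  have hbdd : BddAbove A := ⟨r₀, fun r hr => le_of_not_gt fun h => hr₀ (hdown r hr r₀ h.le)⟩
  have hnonneg : 0 ≤ sSup A := le_csSup hbdd hzero
  have hlt : ∀ r < sSup A, r ∈ A := fun r hr => by
    obtain ⟨r', hr', h⟩ := exists_lt_of_lt_csSup ⟨0, hzero⟩ hr
    exact hdown r' hr' r h.le
  have hmem : sSup A ∈ A := by
    rcases hnonneg.eq_or_lt with h | hpos
    · rwa [← h]
    · exact hX.isCompact_closedBall_of_forall_lt p hpos hlt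
  obtain ⟨r, hr, hrA⟩ := hX.exists_lt_isCompact_closedBall hnonneg hmem
  exact hr.not_ge (le_csSup hbdd hrA)

theorem exists_lipschitzOnWith_one_limit [ProperSpace X] {ι : Type*} (U : Ultrafilter ι)
    {σ : ι → ℝ → X} {s : Set ℝ} {t₀ : ℝ} {x : X} (ht₀ : t₀ ∈ s) (hx : ∀ i, σ i t₀ = x)
    (hσ : ∀ i, LipschitzOnWith 1 (σ i) s) :
    ∃ γ : ℝ → X, LipschitzOnWith 1 γ s ∧ ∀ t ∈ s, Tendsto (σ · t) U (𝓝 (γ t)) := by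
  have hlim : ∀ t ∈ s, ∃ z, Tendsto (σ · t) U (𝓝 z) := by
    intro t ht
    have hball : ∀ i, σ i t ∈ Metric.closedBall x |t - t₀| := fun i => by
      rw [Metric.mem_closedBall, ← hx i]
      exact dist_le_abs_sub_of_lipschitzOnWith_one (hσ i) ht ht₀
    obtain ⟨z, -, hz⟩ := (isCompact_closedBall x |t - t₀|).ultrafilter_le_nhds
      (U.map (σ · t)) (tendsto_principal.2 (Eventually.of_forall hball))
    exact ⟨z, hz⟩
  have : Nonempty X := ⟨x⟩
  choose! γ hγ using hlim
  exact ⟨γ, LipschitzOnWith.mk_one fun u hu v hv => le_of_tendsto' ((hγ u hu).dist (hγ v hv))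
    fun i => dist_le_abs_sub_of_lipschitzOnWith_one (hσ i) hu hv, hγ⟩

end Proper

theorem IsLengthSpace.isGeodesicSpace [MetricSpace X] [ProperSpace X] (hX : IsLengthSpace X) :
    IsGeodesicSpace X := by
  intro x y
  choose σ l hl0 hl hσ0 hσl hσ using fun n : ℕ =>
    hX x y (1 / ((n : ℝ) + 1)) Nat.one_div_pos_of_nat
  set D := dist x y
  have hD : D ∈ Icc 0 D := right_mem_Icc.2 dist_nonneg
  have h0 : (0 : ℝ) ∈ Icc 0 D := left_mem_Icc.2 dist_nonneg
  have hDl : ∀ n, D ≤ l n := fun n => by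
    have h := dist_le_abs_sub_of_lipschitzOnWith_one (hσ n) (left_mem_Icc.2 (hl0 n))
      (right_mem_Icc.2 (hl0 n))
    rwa [hσ0, hσl, zero_sub, abs_neg, abs_of_nonneg (hl0 n)] at h
  obtain ⟨γ, hLip, hγ⟩ := exists_lipschitzOnWith_one_limit (hyperfilter ℕ) h0 hσ0
    fun n => (hσ n).mono (Icc_subset_Icc_right (hDl n))
  have hγ0 : γ 0 = x := tendsto_nhds_unique (hγ 0 h0) (by simp only [hσ0, tendsto_const_nhds])
  have hγD : γ D = y := by
    refine tendsto_nhds_unique (hγ D hD) (tendsto_iff_dist_tendsto_zero.2 ?_)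
    refine squeeze_zero (fun _ => dist_nonneg) (fun n => ?_)
      (tendsto_one_div_add_atTop_nhds_zero_nat.mono_left Nat.hyperfilter_le_atTop)
    have h := dist_le_abs_sub_of_lipschitzOnWith_one (hσ n) (Icc_subset_Icc_right (hDl n) hD)
      (right_mem_Icc.2 (hl0 n))
    rw [hσl, abs_sub_comm, abs_of_nonneg (sub_nonneg.2 (hDl n))] at h
    linarith [hl n]
  exact ⟨_, γ, 0, D, isGeodesic_of_lipschitzOnWith_one dist_nonneg hLip
    (by rw [hγ0, hγD, sub_zero]), hγ0, hγD, rfl⟩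

end HopfRinow

section Disc

open ComplexConjugate

theorem tanh_add_eq_div (s t : ℝ) :
    Real.tanh (s + t) = (Real.tanh s + Real.tanh t) / (1 + Real.tanh t * Real.tanh s) := by
  have hs := (Real.cosh_pos s).ne'
  have ht := (Real.cosh_pos t).ne'
  rw [Real.tanh_eq_sinh_div_cosh, Real.sinh_add, Real.cosh_add, Real.tanh_eq_sinh_div_cosh,
    Real.tanh_eq_sinh_div_cosh, div_add_div _ _ hs ht, div_mul_div_comm,
    one_add_div (mul_ne_zero ht hs), div_div_div_eq,
    mul_comm (Real.cosh t) (Real.cosh s), mul_comm (Real.sinh t) (Real.sinh s),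
    mul_comm (Real.cosh s * Real.cosh t) (_ + _), mul_div_mul_right _ _ (mul_ne_zero hs ht)]

theorem tanh_pos {t : ℝ} (ht : 0 < t) : 0 < Real.tanh t := by
  rw [Real.tanh_eq_sinh_div_cosh]
  exact div_pos (Real.sinh_pos_iff.2 ht) (Real.cosh_pos t)

theorem abs_tanh (t : ℝ) : |Real.tanh t| = Real.tanh |t| := by
  rcases lt_trichotomy t 0 with ht | rfl | ht
  · rw [abs_of_neg ht, ← abs_neg, ← Real.tanh_neg, abs_of_pos (tanh_pos (neg_pos.2 ht))]
  · simp
  · rw [abs_of_pos ht, abs_of_pos (tanh_pos ht)]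

theorem hasDerivAt_tanh (t : ℝ) : HasDerivAt Real.tanh (1 - Real.tanh t ^ 2) t := by
  have hc := (Real.cosh_pos t).ne'
  rw [show Real.tanh = Real.sinh / Real.cosh from funext Real.tanh_eq_sinh_div_cosh]
  refine ((Real.hasDerivAt_sinh t).div (Real.hasDerivAt_cosh t) hc).congr_deriv ?_
  rw [Pi.div_apply]
  field_simp

theorem tanh_le_self {t : ℝ} (ht : 0 ≤ t) : Real.tanh t ≤ t := by
  have hmono : Monotone fun x : ℝ => x - Real.tanh x :=
    monotone_of_hasDerivAt_nonneg
      (fun x => ((hasDerivAt_id x).sub (hasDerivAt_tanh x)).congr_deriv (sub_sub_cancel _ _))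
      (fun x => sq_nonneg _)
  simpa using hmono ht

theorem ofReal_tanh_mem_ball (t : ℝ) : (Real.tanh t : ℂ) ∈ Metric.ball (0 : ℂ) 1 := by
  rw [mem_ball_zero_iff, Complex.norm_real]
  exact Real.abs_tanh_lt_one t

/-- For `‖a‖ < 1`, the automorphism of the unit disc that moves `0` to `a` along the diameter
through `a`. -/
noncomputable def discAut (a ζ : ℂ) : ℂ := (ζ + a) / (1 + conj a * ζ)

@[simp]
theorem discAut_zero (a : ℂ) : discAut a 0 = a := by simp [discAut]

theorem discAut_tanh (s t : ℝ) : discAut (Real.tanh t) (Real.tanh s) = Real.tanh (s + t) := by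
  rw [discAut, Complex.conj_ofReal, tanh_add_eq_div]
  push_cast
  rfl

theorem one_add_conj_mul_ne_zero {a ζ : ℂ} (ha : ‖a‖ < 1) (hζ : ‖ζ‖ < 1) :
    1 + conj a * ζ ≠ 0 := by
  intro h
  have hlt : ‖conj a * ζ‖ < 1 := by
    rw [norm_mul, RCLike.norm_conj]
    exact mul_lt_one_of_nonneg_of_lt_one_left (norm_nonneg a) ha hζ.le
  rw [eq_neg_of_add_eq_zero_right h, norm_neg, norm_one] at hlt
  exact hlt.false

theorem norm_discAut_lt_one {a ζ : ℂ} (ha : ‖a‖ < 1) (hζ : ‖ζ‖ < 1) : ‖discAut a ζ‖ < 1 := by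
  rw [discAut, norm_div, div_lt_one (norm_pos_iff.2 (one_add_conj_mul_ne_zero ha hζ))]
  refine lt_of_pow_lt_pow_left₀ 2 (norm_nonneg _) (sub_pos.1 ?_)
  have hid : ‖1 + conj a * ζ‖ ^ 2 - ‖ζ + a‖ ^ 2 = (1 - ‖a‖ ^ 2) * (1 - ‖ζ‖ ^ 2) := by
    simp only [← Complex.normSq_eq_norm_sq, Complex.normSq_apply, Complex.add_re, Complex.add_im,
      Complex.mul_re, Complex.mul_im, Complex.conj_re, Complex.conj_im, Complex.one_re,
      Complex.one_im]
    ring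
  rw [hid]
  exact mul_pos (sub_pos.2 (pow_lt_one₀ (norm_nonneg _) ha two_ne_zero))
    (sub_pos.2 (pow_lt_one₀ (norm_nonneg _) hζ two_ne_zero))

theorem mapsTo_discAut {a : ℂ} (ha : ‖a‖ < 1) :
    MapsTo (discAut a) (Metric.ball 0 1) (Metric.ball 0 1) := fun ζ hζ => by
  rw [mem_ball_zero_iff] at hζ ⊢
  exact norm_discAut_lt_one ha hζ

theorem differentiableOn_discAut {a : ℂ} (ha : ‖a‖ < 1) :
    DifferentiableOn ℂ (discAut a) (Metric.ball 0 1) := by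
  intro ζ hζ
  have := one_add_conj_mul_ne_zero ha (mem_ball_zero_iff.1 hζ)
  unfold discAut
  exact DifferentiableAt.differentiableWithinAt (by fun_prop (disch := assumption))

theorem discAut_discAut_neg {a b : ℂ} (ha : ‖a‖ < 1) (hb : ‖b‖ < 1) :
    discAut a (discAut (-a) b) = b := by
  have hna : ‖-a‖ < 1 := by rwa [norm_neg]
  have hden := one_add_conj_mul_ne_zero hna hb
  rw [discAut, div_eq_iff (one_add_conj_mul_ne_zero ha (norm_discAut_lt_one hna hb)), discAut]
  linear_combination div_mul_cancel₀ (b + -a) hden -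
    (b * ((b + -a) / (1 + conj (-a) * b))) * (map_neg conj a)

theorem poincareDist_eq_artanh_norm (a b : ℂ) :
    poincareDist a b = Real.artanh ‖discAut (-a) b‖ := by
  have hden : ‖1 - conj b * a‖ = ‖1 + conj (-a) * b‖ := by
    rw [← RCLike.norm_conj (1 - _)]
    simp only [map_sub, map_one, map_mul, RCLike.conj_conj, map_neg]
    ring_nf
  rw [poincareDist, discAut, norm_div, norm_sub_rev, sub_eq_add_neg, hden]

theorem poincareDist_nonneg (a b : ℂ) : 0 ≤ poincareDist a b :=
  Real.artanh_nonneg (by positivity)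

theorem poincareDist_comm (a b : ℂ) : poincareDist a b = poincareDist b a := by
  rw [poincareDist, poincareDist, norm_sub_rev a b, ← RCLike.norm_conj (1 - _)]
  simp only [map_sub, map_one, map_mul, RCLike.conj_conj, mul_comm]

theorem poincareDist_tanh (s t : ℝ) : poincareDist (Real.tanh s) (Real.tanh t) = |s - t| := by
  rw [poincareDist_eq_artanh_norm, ← Complex.ofReal_neg, ← Real.tanh_neg, discAut_tanh,
    Complex.norm_real, Real.norm_eq_abs, abs_tanh, Real.artanh_tanh, ← sub_eq_add_neg,
    abs_sub_comm]

namespace IsHolomorphicDisc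

variable {d : ℕ} {M : Set (CSpace d)} {f : ℂ → CSpace d}

theorem comp (hf : IsHolomorphicDisc M f) {g : ℂ → ℂ}
    (hg : DifferentiableOn ℂ g (Metric.ball 0 1))
    (hmaps : MapsTo g (Metric.ball 0 1) (Metric.ball 0 1)) : IsHolomorphicDisc M (f ∘ g) :=
  ⟨hf.1.comp hg hmaps, hf.2.comp hmaps⟩

theorem exists_eq_zero_and_eq_tanh (hf : IsHolomorphicDisc M f) {a b : ℂ}
    (ha : a ∈ Metric.ball (0 : ℂ) 1) (hb : b ∈ Metric.ball (0 : ℂ) 1) :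
    ∃ g, IsHolomorphicDisc M g ∧ g 0 = f a ∧ g (Real.tanh (poincareDist a b)) = f b := by
  rw [mem_ball_zero_iff] at ha hb
  have hlt : ‖discAut (-a) b‖ < 1 := norm_discAut_lt_one (by rwa [norm_neg]) hb
  obtain ⟨u, hu, huw⟩ : ∃ u : ℂ, ‖u‖ = 1 ∧ u * ‖discAut (-a) b‖ = discAut (-a) b :=
    ⟨Complex.exp (Complex.arg (discAut (-a) b) * Complex.I), Complex.norm_exp_ofReal_mul_I _, by
      rw [mul_comm, Complex.norm_mul_exp_arg_mul_I]⟩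
  have hmul : MapsTo (u * ·) (Metric.ball (0 : ℂ) 1) (Metric.ball 0 1) := fun ζ hζ => by
    rw [mem_ball_zero_iff] at hζ ⊢
    rwa [norm_mul, hu, one_mul]
  refine ⟨_, (hf.comp (differentiableOn_discAut ha) (mapsTo_discAut ha)).comp
    (g := (u * ·)) (by fun_prop) hmul, by simp, ?_⟩
  rw [poincareDist_eq_artanh_norm,
    Real.tanh_artanh ⟨neg_one_lt_zero.trans_le (norm_nonneg _), hlt⟩,
    Function.comp_apply, Function.comp_apply, huw, discAut_discAut_neg ha hb]

theorem hasDerivAt_comp_tanh_sub (hf : IsHolomorphicDisc M f) (t : ℝ) :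
    HasDerivAt (fun s : ℝ => f (Real.tanh (s - t))) (deriv f 0) t := by
  have htanh : HasDerivAt (fun s : ℝ => (Real.tanh (s - t) : ℂ)) 1 t := by
    have h := (hasDerivAt_tanh (t - t)).comp_sub_const t t
    rw [sub_self, Real.tanh_zero, zero_pow two_ne_zero, sub_zero] at h
    exact mod_cast h.ofReal_comp
  have hf0 : HasDerivAt f (deriv f 0) (Real.tanh (t - t) : ℂ) := by
    rw [sub_self, Real.tanh_zero, Complex.ofReal_zero]
    exact (hf.1.differentiableAt (Metric.ball_mem_nhds 0 one_pos)).hasDerivAt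
  have h := hf0.scomp t htanh
  rwa [one_smul] at h

theorem kobayashiRoyden_deriv_le_one (hf : IsHolomorphicDisc M f) :
    kobayashiRoyden M (f 0) (deriv f 0) ≤ 1 :=
  sInf_le ⟨f, 1, hf, rfl, one_smul _ _, by simp⟩

/-- The addition theorem for `tanh` turns the curve into the image of the real diameter under the
disc `f ∘ discAut (tanh (t - a))`, whose centre is the point of the curve at `t`. -/
theorem kobayashiRoyden_deriv_comp_tanh_sub_le_one (hf : IsHolomorphicDisc M f) (a t : ℝ) :
    DifferentiableAt ℝ (fun s : ℝ => f (Real.tanh (s - a))) t ∧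
      kobayashiRoyden M (f (Real.tanh (t - a)))
        (deriv (fun s : ℝ => f (Real.tanh (s - a))) t) ≤ 1 := by
  have ha := mem_ball_zero_iff.1 (ofReal_tanh_mem_ball (t - a))
  have hdisc : IsHolomorphicDisc M (f ∘ discAut (Real.tanh (t - a))) :=
    hf.comp (differentiableOn_discAut ha) (mapsTo_discAut ha)
  have hderiv := hdisc.hasDerivAt_comp_tanh_sub t
  have hRoyden := hdisc.kobayashiRoyden_deriv_le_one
  simp only [Function.comp_apply, discAut_tanh, sub_add_sub_cancel] at hderiv
  rw [Function.comp_apply, discAut_zero] at hRoyden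
  exact ⟨hderiv.differentiableAt, by rwa [hderiv.deriv]⟩

theorem dist_le_diam_mul_poincareDist (hf : IsHolomorphicDisc M f) (hM : Bornology.IsBounded M)
    {a b : ℂ} (ha : a ∈ Metric.ball (0 : ℂ) 1) (hb : b ∈ Metric.ball (0 : ℂ) 1) :
    dist (f a) (f b) ≤ Metric.diam M * poincareDist a b := by
  obtain ⟨g, hg, hga, hgb⟩ := hf.exists_eq_zero_and_eq_tanh ha hb
  have hmaps : MapsTo g (Metric.ball 0 1) (Metric.closedBall (g 0) (Metric.diam M)) :=
    fun ζ hζ => Metric.dist_le_diam_of_mem hM (hg.2 hζ) (hg.2 (Metric.mem_ball_self one_pos))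
  have hschwarz := Complex.dist_le_div_mul_dist_of_mapsTo_ball hg.1 hmaps
    (ofReal_tanh_mem_ball (poincareDist a b))
  have hp := poincareDist_nonneg a b
  rw [hga, hgb, dist_zero_right, Complex.norm_real, Real.norm_eq_abs, abs_tanh, abs_of_nonneg hp,
    div_one, dist_comm] at hschwarz
  exact hschwarz.trans (mul_le_mul_of_nonneg_left (tanh_le_self hp) Metric.diam_nonneg)

end IsHolomorphicDisc

end Disc

section Chains

variable {d : ℕ} {M : Set (CSpace d)} {z w v : CSpace d} {c e : ℝ}

namespace IsDiscChainLength

theorem nonneg (h : IsDiscChainLength M z w c) : 0 ≤ c := by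
  obtain ⟨n, p, f, a, b, -, -, -, rfl⟩ := h
  exact Finset.sum_nonneg fun j _ => poincareDist_nonneg _ _

theorem refl (M : Set (CSpace d)) (z : CSpace d) : IsDiscChainLength M z z 0 :=
  ⟨0, fun _ => z, fun _ _ => z, fun _ => 0, fun _ => 0, rfl, rfl, by simp, by simp⟩

theorem symm (h : IsDiscChainLength M z w c) : IsDiscChainLength M w z c := by
  obtain ⟨n, p, f, a, b, rfl, rfl, h, rfl⟩ := h
  refine ⟨n, fun j => p (n - j), fun j => f (n - 1 - j), fun j => b (n - 1 - j),
    fun j => a (n - 1 - j), by simp, by simp, fun j hj => ?_, ?_⟩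
  · obtain ⟨hf, ha, hb, hfa, hfb⟩ := h (n - 1 - j) (by omega)
    exact ⟨hf, hb, ha, hfb.trans (congrArg p (by omega)), hfa.trans (congrArg p (by omega))⟩
  · rw [← Finset.sum_range_reflect]
    exact Finset.sum_congr rfl fun j _ => poincareDist_comm _ _

theorem trans (h : IsDiscChainLength M z w c) (h' : IsDiscChainLength M w v e) :
    IsDiscChainLength M z v (c + e) := by
  obtain ⟨n, p, f, a, b, rfl, rfl, h, rfl⟩ := h
  obtain ⟨m, p', f', a', b', hp, rfl, h', rfl⟩ := h'
  refine ⟨n + m, fun j => if j < n then p j else p' (j - n),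
    fun j => if j < n then f j else f' (j - n), fun j => if j < n then a j else a' (j - n),
    fun j => if j < n then b j else b' (j - n), ?_, by simp, fun j hj => ?_, ?_⟩
  · rcases Nat.eq_zero_or_pos n with rfl | hn
    · exact hp
    · exact if_pos hn
  · by_cases hjn : j < n
    · obtain ⟨hf, ha, hb, hfa, hfb⟩ := h j hjn
      simp only [hjn, if_true]
      refine ⟨hf, ha, hb, hfa, hfb.trans ?_⟩
      split_ifs with hj1
      · rfl
      · rw [show n = j + 1 by omega] at hp ⊢
        rw [Nat.sub_self, hp]
    · obtain ⟨hf, ha, hb, hfa, hfb⟩ := h' (j - n) (by omega)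
      simp only [hjn, if_false, if_neg (show ¬ j + 1 < n by omega)]
      exact ⟨hf, ha, hb, hfa, hfb.trans (congrArg p' (by omega))⟩
  · rw [Finset.sum_range_add]
    congr 1
    · exact Finset.sum_congr rfl fun j hj => by simp only [Finset.mem_range.1 hj, if_true]
    · exact Finset.sum_congr rfl fun j _ => by simp

theorem kobayashiDist_le (h : IsDiscChainLength M z w c) : kobayashiDist M z w ≤ c :=
  csInf_le ⟨0, fun _ h => h.nonneg⟩ h

theorem dist_le (hM : Bornology.IsBounded M) (h : IsDiscChainLength M z w c) :
    dist z w ≤ Metric.diam M * c := by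
  obtain ⟨n, p, f, a, b, rfl, rfl, h, rfl⟩ := h
  rw [Finset.mul_sum]
  refine dist_le_range_sum_of_dist_le n fun {j} hj => ?_
  obtain ⟨hf, ha, hb, hfa, hfb⟩ := h j hj
  rw [← hfa, ← hfb]
  exact hf.dist_le_diam_mul_poincareDist hM ha hb

end IsDiscChainLength

theorem IsHolomorphicDisc.isDiscChainLength {f : ℂ → CSpace d} (hf : IsHolomorphicDisc M f)
    {a b : ℂ} (ha : a ∈ Metric.ball (0 : ℂ) 1) (hb : b ∈ Metric.ball (0 : ℂ) 1) :
    IsDiscChainLength M (f a) (f b) (poincareDist a b) := by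
  refine ⟨1, fun j => if j = 0 then f a else f b, fun _ => f, fun _ => a, fun _ => b, rfl, rfl,
    fun j hj => ?_, by rw [Finset.sum_range_one]⟩
  obtain rfl : j = 0 := Nat.lt_one_iff.1 hj
  exact ⟨hf, ha, hb, rfl, rfl⟩

theorem kobayashiDist_nonneg (z w : CSpace d) : 0 ≤ kobayashiDist M z w :=
  Real.sInf_nonneg fun _ h => IsDiscChainLength.nonneg h

theorem kobayashiDist_self (z : CSpace d) : kobayashiDist M z z = 0 :=
  (IsDiscChainLength.refl M z).kobayashiDist_le.antisymm (kobayashiDist_nonneg z z)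

theorem kobayashiDist_comm (z w : CSpace d) : kobayashiDist M z w = kobayashiDist M w z :=
  congrArg sInf (Set.ext fun _ => ⟨fun h => h.symm, fun h => h.symm⟩)

/-- Any two points of `M` are joined by a chain of holomorphic discs. Without it `kobayashiDist M`
has junk values, the infimum of the empty set being `0`. -/
class IsDiscChainConnected (M : Set (CSpace d)) : Prop where
  exists_isDiscChainLength : ∀ z ∈ M, ∀ w ∈ M, ∃ c, IsDiscChainLength M z w c

section Connected

variable [IsDiscChainConnected M] (hz : z ∈ M) (hw : w ∈ M)

include hz hw

theorem exists_isDiscChainLength_lt (hc : kobayashiDist M z w < c) :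
    ∃ c' < c, IsDiscChainLength M z w c' := by
  obtain ⟨c', hc', h⟩ :=
    exists_lt_of_csInf_lt (IsDiscChainConnected.exists_isDiscChainLength z hz w hw) hc
  exact ⟨c', h, hc'⟩

theorem kobayashiDist_triangle (hv : v ∈ M) :
    kobayashiDist M z v ≤ kobayashiDist M z w + kobayashiDist M w v := by
  refine le_of_forall_pos_le_add fun ε hε => ?_
  obtain ⟨c, hc, h⟩ := exists_isDiscChainLength_lt hz hw (lt_add_of_pos_right _ (half_pos hε))
  obtain ⟨e, he, h'⟩ := exists_isDiscChainLength_lt hw hv (lt_add_of_pos_right _ (half_pos hε))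
  linarith [(h.trans h').kobayashiDist_le]

theorem dist_le_diam_mul_kobayashiDist (hM : Bornology.IsBounded M) :
    dist z w ≤ Metric.diam M * kobayashiDist M z w := by
  obtain ⟨u, -, hu, hchain⟩ := exists_seq_tendsto_sInf
    (IsDiscChainConnected.exists_isDiscChainLength z hz w hw) ⟨0, fun _ => IsDiscChainLength.nonneg⟩
  exact ge_of_tendsto' (hu.const_mul _) fun n => IsDiscChainLength.dist_le hM (hchain n)

end Connected

end Chains

section Submanifold

variable {d : ℕ} {M : Set (CSpace d)}

/-- The disc `ζ ↦ Φ p + (ζ / tanh ε) • (Φ z - Φ p)` of the chart takes the values `Φ p` and `Φ z` at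
the points `0` and `tanh ε`, which have Poincaré distance `ε`. -/
theorem isDiscChainLength_of_chart {Φ : OpenPartialHomeomorph (CSpace d) (CSpace d)}
    {L : Submodule ℂ (CSpace d)} (hΦ : DifferentiableOn ℂ Φ.symm Φ.target)
    (hML : ∀ z ∈ Φ.source, z ∈ M ↔ Φ z ∈ L) {p z : CSpace d} (hp : p ∈ M ∩ Φ.source)
    (hz : z ∈ M ∩ Φ.source) {r ε : ℝ} (hball : Metric.ball (Φ p) r ⊆ Φ.target) (hε : 0 < ε)
    (hr : dist (Φ z) (Φ p) < r * Real.tanh ε) : IsDiscChainLength M p z ε := by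
  have hpL := (hML p hp.2).1 hp.1
  have ht := tanh_pos hε
  set g : ℂ → CSpace d := fun ζ => Φ p + (ζ / Real.tanh ε) • (Φ z - Φ p) with hg_def
  have hg : MapsTo g (Metric.ball 0 1) Φ.target := fun ζ hζ => hball <| by
    rw [mem_ball_zero_iff] at hζ
    rw [dist_eq_norm] at hr
    rw [mem_ball_iff_norm, hg_def, add_sub_cancel_left, norm_smul, norm_div, Complex.norm_real,
      Real.norm_of_nonneg ht.le, div_mul_eq_mul_div, div_lt_iff₀ ht]
    exact (mul_le_of_le_one_left (norm_nonneg _) hζ.le).trans_lt hr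
  have hdisc : IsHolomorphicDisc M (Φ.symm ∘ g) := by
    refine ⟨hΦ.comp (by fun_prop) hg, fun ζ hζ => ?_⟩
    rw [Function.comp_apply, hML _ (Φ.map_target (hg hζ)), Φ.right_inv (hg hζ)]
    exact L.add_mem hpL (L.smul_mem _ (L.sub_mem ((hML z hz.2).1 hz.1) hpL))
  have h := hdisc.isDiscChainLength (ofReal_tanh_mem_ball 0) (ofReal_tanh_mem_ball ε)
  have hstart : Φ.symm (g (Real.tanh 0 : ℝ)) = p := by
    simp only [hg_def]
    rw [Real.tanh_zero, Complex.ofReal_zero, zero_div, zero_smul, add_zero,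
      Φ.left_inv hp.2]
  have hend : Φ.symm (g (Real.tanh ε : ℝ)) = z := by
    simp only [hg_def]
    rw [div_self (Complex.ofReal_ne_zero.2 ht.ne'), one_smul, add_sub_cancel,
      Φ.left_inv hz.2]
  rwa [poincareDist_tanh, zero_sub, abs_neg, abs_of_pos hε, Function.comp_apply,
    Function.comp_apply, hstart, hend] at h

namespace IsEmbeddedComplexSubmanifold

theorem eventually_isDiscChainLength (hM : IsEmbeddedComplexSubmanifold M) {p : CSpace d}
    (hp : p ∈ M) {ε : ℝ} (hε : 0 < ε) : ∀ᶠ z in 𝓝[M] p, IsDiscChainLength M p z ε := by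
  obtain ⟨Φ, L, hpΦ, -, hΦ, hML⟩ := hM p hp
  obtain ⟨r, hr, hball⟩ := Metric.isOpen_iff.1 Φ.open_target (Φ p) (Φ.map_source hpΦ)
  have hnear := (Φ.continuousAt hpΦ).eventually
    (Metric.ball_mem_nhds (Φ p) (mul_pos hr (tanh_pos hε)))
  filter_upwards [nhdsWithin_le_nhds hnear, nhdsWithin_le_nhds (Φ.open_source.mem_nhds hpΦ),
    self_mem_nhdsWithin] with z hz hzΦ hzM
  exact isDiscChainLength_of_chart hΦ hML ⟨hp, hpΦ⟩ ⟨hzM, hzΦ⟩ hball hε hz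

theorem isDiscChainConnected (hM : IsEmbeddedComplexSubmanifold M) (hconn : IsPreconnected M) :
    IsDiscChainConnected M := by
  refine ⟨fun z hz w hw => hconn.induction₂ (fun z w => ∃ c, IsDiscChainLength M z w c)
    (fun x hx => ?_) ?_ ?_ hz hw⟩
  · filter_upwards [hM.eventually_isDiscChainLength hx one_pos] with y hy
    exact ⟨1, hy⟩
  · rintro x y z - - - ⟨c, h⟩ ⟨e, h'⟩
    exact ⟨c + e, h.trans h'⟩
  · rintro x y - - ⟨c, h⟩
    exact ⟨c, h.symm⟩

theorem isLocallyClosed (hM : IsEmbeddedComplexSubmanifold M) : IsLocallyClosed M := by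
  refine ((isLocallyClosed_tfae M).out 0 2).2 fun p hp => ?_
  obtain ⟨Φ, L, hpΦ, -, -, hML⟩ := hM p hp
  refine ⟨Φ.source, Φ.open_source.mem_nhds hpΦ, ?_⟩
  have hpreimage : (Subtype.val ⁻¹' M : Set Φ.source) = Φ.source.domRestrict Φ ⁻¹' L :=
    Set.ext fun z => hML z.1 z.2
  rw [hpreimage]
  exact L.closed_of_finiteDimensional.preimage
    (continuousOn_iff_continuous_domRestrict.1 Φ.continuousOn)

end IsEmbeddedComplexSubmanifold

end Submanifold

section Gluing

variable {X : Type*} [PseudoMetricSpace X] {σ τ : ℝ → X} {a b c : ℝ}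

theorem lipschitzOnWith_one_Icc_trans (hab : a ≤ b) (hbc : b ≤ c)
    (h : LipschitzOnWith 1 σ (Icc a b)) (h' : LipschitzOnWith 1 σ (Icc b c)) :
    LipschitzOnWith 1 σ (Icc a c) := by
  have key : ∀ s ∈ Icc a c, ∀ t ∈ Icc a c, s ≤ t → dist (σ s) (σ t) ≤ dist s t := by
    intro s hs t ht hst
    rw [Real.dist_eq]
    rcases le_total t b with htb | hbt
    · exact dist_le_abs_sub_of_lipschitzOnWith_one h ⟨hs.1, hst.trans htb⟩ ⟨ht.1, htb⟩
    rcases le_total b s with hbs | hsb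
    · exact dist_le_abs_sub_of_lipschitzOnWith_one h' ⟨hbs, hs.2⟩ ⟨hbt, ht.2⟩
    have hsb' := dist_le_abs_sub_of_lipschitzOnWith_one h ⟨hs.1, hsb⟩ ⟨hab, le_rfl⟩
    have hbt' := dist_le_abs_sub_of_lipschitzOnWith_one h' ⟨le_rfl, hbc⟩ ⟨hbt, ht.2⟩
    rw [abs_of_nonpos (sub_nonpos.2 ‹_›)] at hsb' hbt' ⊢
    linarith [dist_triangle (σ s) (σ b) (σ t)]
  refine LipschitzOnWith.mk_one fun s hs t ht => ?_
  rcases le_total s t with hst | hts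
  · exact key s hs t ht hst
  · rw [dist_comm, dist_comm s]
    exact key t ht s hs hts

end Gluing

section KobayashiSpace

variable {d : ℕ} {M : Set (CSpace d)}

/-- `M` as a type of its own, to carry the Kobayashi distance instead of the Euclidean one. -/
@[ext]
structure KobayashiSpace (M : Set (CSpace d)) where
  val : CSpace d
  mem : val ∈ M

namespace KobayashiSpace

variable [IsDiscChainConnected M]

noncomputable instance : PseudoMetricSpace (KobayashiSpace M) where
  dist p q := kobayashiDist M p.val q.val
  dist_self p := kobayashiDist_self p.val
  dist_comm p q := kobayashiDist_comm p.val q.val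
  dist_triangle p q r := kobayashiDist_triangle p.mem q.mem r.mem

theorem dist_def (p q : KobayashiSpace M) : dist p q = kobayashiDist M p.val q.val := rfl

theorem dist_val_le (hM : Bornology.IsBounded M) (p q : KobayashiSpace M) :
    dist p.val q.val ≤ Metric.diam M * dist p q :=
  dist_le_diam_mul_kobayashiDist p.mem q.mem hM

theorem lipschitzWith_val (hM : Bornology.IsBounded M) :
    LipschitzWith (Metric.diam M).toNNReal (val : KobayashiSpace M → CSpace d) :=
  LipschitzWith.of_dist_le_mul fun p q => by
    rw [Real.coe_toNNReal _ Metric.diam_nonneg]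
    exact dist_val_le hM p q

noncomputable instance [hM : Fact (Bornology.IsBounded M)] : MetricSpace (KobayashiSpace M) where
  eq_of_dist_eq_zero {p q} h := by
    have hle := dist_val_le hM.out p q
    rw [h, mul_zero] at hle
    exact KobayashiSpace.ext (dist_le_zero.1 hle)

end KobayashiSpace

/-- The restriction of `σ` to `[a, b]` has speed at most `1`, for the Kobayashi distance as well as
for the Kobayashi–Royden metric. -/
structure IsSubunitCurve [IsDiscChainConnected M] (σ : ℝ → KobayashiSpace M) (a b : ℝ) : Prop where
  le : a ≤ b
  lipschitzOnWith : LipschitzOnWith 1 σ (Icc a b)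
  ae_kobayashiRoyden_le : ∀ᵐ t ∂(volume.restrict (Icc a b)),
    DifferentiableAt ℝ (fun t => (σ t).val) t ∧
      kobayashiRoyden M (σ t).val (deriv (fun t => (σ t).val) t) ≤ 1

variable [IsDiscChainConnected M]

theorem IsHolomorphicDisc.exists_isSubunitCurve {f : ℂ → CSpace d} (hf : IsHolomorphicDisc M f)
    {a b : ℂ} (ha : a ∈ Metric.ball (0 : ℂ) 1) (hb : b ∈ Metric.ball (0 : ℂ) 1) (t₀ : ℝ) :
    ∃ σ : ℝ → KobayashiSpace M, IsSubunitCurve σ t₀ (t₀ + poincareDist a b) ∧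
      (σ t₀).val = f a ∧ (σ (t₀ + poincareDist a b)).val = f b := by
  obtain ⟨g, hg, hga, hgb⟩ := hf.exists_eq_zero_and_eq_tanh ha hb
  have hgM : ∀ t : ℝ, g (Real.tanh t) ∈ M := fun t => hg.2 (ofReal_tanh_mem_ball t)
  refine ⟨fun t => ⟨g (Real.tanh (t - t₀)), hgM (t - t₀)⟩,
    ⟨le_add_of_nonneg_right (poincareDist_nonneg a b), ?_, Eventually.of_forall fun t =>
      hg.kobayashiRoyden_deriv_comp_tanh_sub_le_one t₀ t⟩, ?_, ?_⟩
  · refine LipschitzOnWith.mk_one fun s _ t _ => ?_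
    have h := hg.isDiscChainLength (ofReal_tanh_mem_ball (s - t₀)) (ofReal_tanh_mem_ball (t - t₀))
    rw [poincareDist_tanh, sub_sub_sub_cancel_right] at h
    exact h.kobayashiDist_le
  · change g (Real.tanh (t₀ - t₀)) = f a
    rw [sub_self, Real.tanh_zero, Complex.ofReal_zero, hga]
  · change g (Real.tanh (t₀ + poincareDist a b - t₀)) = f b
    rw [add_sub_cancel_left, hgb]

theorem IsSubunitCurve.congr {σ τ : ℝ → KobayashiSpace M} {a b : ℝ} (h : IsSubunitCurve σ a b)
    (heq : EqOn τ σ (Icc a b)) : IsSubunitCurve τ a b := by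
  refine ⟨h.le, fun s hs t ht => by
    rw [heq hs, heq ht]
    exact h.lipschitzOnWith hs ht, ?_⟩
  have hσ := h.ae_kobayashiRoyden_le
  rw [← restrict_Ioo_eq_restrict_Icc, ae_restrict_iff' measurableSet_Ioo] at hσ ⊢
  filter_upwards [hσ] with t hσt ht
  have hnear : (fun s => (τ s).val) =ᶠ[𝓝 t] fun s => (σ s).val := by
    filter_upwards [Icc_mem_nhds ht.1 ht.2] with s hs using congrArg _ (heq hs)
  rw [hnear.differentiableAt_iff, hnear.deriv_eq, heq (Ioo_subset_Icc_self ht)]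
  exact hσt ht

theorem IsSubunitCurve.trans {σ : ℝ → KobayashiSpace M} {a b c : ℝ} (h : IsSubunitCurve σ a b)
    (h' : IsSubunitCurve σ b c) : IsSubunitCurve σ a c := by
  refine ⟨h.le.trans h'.le,
    lipschitzOnWith_one_Icc_trans h.le h'.le h.lipschitzOnWith h'.lipschitzOnWith, ?_⟩
  rw [← Icc_union_Icc_eq_Icc h.le h'.le, ae_restrict_union_iff]
  exact ⟨h.ae_kobayashiRoyden_le, h'.ae_kobayashiRoyden_le⟩

theorem IsSubunitCurve.exists_glue {σ τ : ℝ → KobayashiSpace M} {a b c : ℝ}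
    (hσ : IsSubunitCurve σ a b) (hτ : IsSubunitCurve τ b c) (hστ : σ b = τ b) :
    ∃ ρ, IsSubunitCurve ρ a c ∧ ρ a = σ a ∧ ρ c = τ c := by
  set ρ : ℝ → KobayashiSpace M := fun t => if t ≤ b then σ t else τ t
  have hρσ : EqOn ρ σ (Iic b) := fun t ht => if_pos ht
  have hρτ : EqOn ρ τ (Ici b) := fun t ht => by
    rcases eq_or_lt_of_le (mem_Ici.1 ht) with rfl | hlt
    · rw [hρσ self_mem_Iic, hστ]
    · exact if_neg hlt.not_ge
  exact ⟨ρ, (hσ.congr (hρσ.mono Icc_subset_Iic_self)).trans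
    (hτ.congr (hρτ.mono Icc_subset_Ici_self)), hρσ hσ.le, hρτ hτ.le⟩

theorem IsDiscChainLength.exists_isSubunitCurve {z w : CSpace d} {c : ℝ}
    (h : IsDiscChainLength M z w c) (hz : z ∈ M) :
    ∃ σ : ℝ → KobayashiSpace M, IsSubunitCurve σ 0 c ∧ (σ 0).val = z ∧ (σ c).val = w := by
  obtain ⟨n, p, f, a, b, rfl, rfl, h, rfl⟩ := h
  induction n with
  | zero =>
    rw [Finset.sum_range_zero]
    refine ⟨fun _ => ⟨p 0, hz⟩, ⟨le_rfl, LipschitzOnWith.mk_one fun _ _ _ _ => ?_, ?_⟩, rfl, rfl⟩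
    · rw [dist_self]
      exact dist_nonneg
    · simp
  | succ n ih =>
    obtain ⟨σ, hσ, hσ0, hσn⟩ := ih fun j hj => h j (hj.trans n.lt_succ_self)
    obtain ⟨hf, ha, hb, hfa, hfb⟩ := h n n.lt_succ_self
    obtain ⟨τ, hτ, hτn, hτe⟩ := hf.exists_isSubunitCurve ha hb _
    obtain ⟨ρ, hρ, hρ0, hρe⟩ :=
      hσ.exists_glue hτ (KobayashiSpace.ext (by rw [hσn, hτn, hfa]))
    rw [Finset.sum_range_succ]
    exact ⟨ρ, hρ, by rw [hρ0, hσ0], by rw [hρe, hτe, hfb]⟩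

namespace KobayashiSpace

theorem exists_isSubunitCurve (x y : KobayashiSpace M) {ε : ℝ} (hε : 0 < ε) :
    ∃ (σ : ℝ → KobayashiSpace M) (l : ℝ),
      l ≤ dist x y + ε ∧ IsSubunitCurve σ 0 l ∧ σ 0 = x ∧ σ l = y := by
  obtain ⟨l, hl, hchain⟩ := exists_isDiscChainLength_lt x.mem y.mem (lt_add_of_pos_right _ hε)
  obtain ⟨σ, hσ, hσ0, hσl⟩ := hchain.exists_isSubunitCurve x.mem
  exact ⟨σ, l, hl.le, hσ, KobayashiSpace.ext hσ0, KobayashiSpace.ext hσl⟩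

theorem isLengthSpace : IsLengthSpace (KobayashiSpace M) := by
  intro x y ε hε
  obtain ⟨σ, l, hl, hσ, hσ0, hσl⟩ := exists_isSubunitCurve x y hε
  exact ⟨σ, l, hσ.le, hl, hσ0, hσl, hσ.lipschitzOnWith⟩

end KobayashiSpace

theorem IsSubunitCurve.isAlmostGeodesic (hM : Bornology.IsBounded M) {σ : ℝ → KobayashiSpace M}
    {a b lam kap : ℝ} (hσ : IsSubunitCurve σ a b) (hab : b - a ≤ dist (σ a) (σ b) + kap)
    (hlam : 1 ≤ lam) (hkap : 0 ≤ kap) :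
    IsAlmostGeodesic M lam kap (fun t => (σ t).val) a b := by
  refine ⟨hσ.le, fun t _ => (σ t).mem, fun s hs t ht => ⟨?_, ?_⟩, ?_, ?_⟩
  · have hlower := abs_sub_le_dist_add_of_lipschitzOnWith_one hσ.lipschitzOnWith hab t ht s hs
    have hscale : 1 / lam * |t - s| ≤ |t - s| :=
      mul_le_of_le_one_left (abs_nonneg _) ((div_le_one (one_pos.trans_le hlam)).2 hlam)
    rw [← KobayashiSpace.dist_def]
    linarith
  · have hupper := dist_le_abs_sub_of_lipschitzOnWith_one hσ.lipschitzOnWith ht hs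
    have hscale : |t - s| ≤ lam * |t - s| := le_mul_of_one_le_left (abs_nonneg _) hlam
    rw [← KobayashiSpace.dist_def]
    linarith
  · have hLip := (KobayashiSpace.lipschitzWith_val hM).comp_lipschitzOnWith hσ.lipschitzOnWith
    rw [← uIcc_of_le hσ.le] at hLip
    exact hLip.absolutelyContinuousOnInterval
  · filter_upwards [hσ.ae_kobayashiRoyden_le] with t ht
    exact ⟨ht.1, ht.2.trans (ENNReal.one_le_ofReal.2 hlam)⟩

end KobayashiSpace

section Visibility

variable {d : ℕ} {M : Set (CSpace d)} {σ : ℝ → CSpace d} {a b lam kap : ℝ}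

namespace KobayashiSpace

theorem exists_forall_val_eq (hab : a ≤ b) (hσ : MapsTo σ (Icc a b) M) :
    ∃ τ : ℝ → KobayashiSpace M, ∀ t ∈ Icc a b, (τ t).val = σ t :=
  ⟨fun t => ⟨σ (projIcc a b hab t), hσ (projIcc a b hab t).2⟩, fun _ ht =>
    congrArg σ (congrArg Subtype.val (projIcc_of_mem hab ht))⟩

variable [IsDiscChainConnected M]

theorem completeSpace (hM : IsKobayashiComplete M) : CompleteSpace (KobayashiSpace M) := by
  refine Metric.complete_of_cauchySeq_tendsto fun u hu => ?_
  obtain ⟨x, hx, hlim⟩ := hM (fun n => (u n).val) (fun n => (u n).mem) (Metric.cauchySeq_iff.1 hu)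
  exact ⟨⟨x, hx⟩, tendsto_iff_dist_tendsto_zero.2 hlim⟩

/-- The Kobayashi distance of a bounded submanifold induces its topology. -/
noncomputable def homeomorph (hM : IsEmbeddedComplexSubmanifold M)
    (hbdd : Bornology.IsBounded M) : M ≃ₜ KobayashiSpace M where
  toFun z := ⟨z.1, z.2⟩
  invFun p := ⟨p.val, p.mem⟩
  left_inv _ := rfl
  right_inv _ := rfl
  continuous_toFun := by
    refine continuous_iff_continuousAt.2 fun p => Metric.tendsto_nhds.2 fun ε hε => ?_
    have hchain := hM.eventually_isDiscChainLength p.2 (half_pos hε)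
    rw [nhdsWithin_eq_map_subtype_coe p.2, eventually_map] at hchain
    filter_upwards [hchain] with z hz
    rw [dist_comm]
    exact hz.kobayashiDist_le.trans_lt (half_lt_self hε)
  continuous_invFun := (lipschitzWith_val hbdd).continuous.subtype_mk _

theorem locallyCompactSpace (hM : IsEmbeddedComplexSubmanifold M)
    (hbdd : Bornology.IsBounded M) : LocallyCompactSpace (KobayashiSpace M) :=
  have := hM.isLocallyClosed.locallyCompactSpace
  (homeomorph hM hbdd).symm.isClosedEmbedding.locallyCompactSpace

theorem isCompact_val_preimage (hM : IsEmbeddedComplexSubmanifold M)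
    (hbdd : Bornology.IsBounded M) {K : Set (CSpace d)} (hKM : K ⊆ M) (hK : IsCompact K) :
    IsCompact (val ⁻¹' K : Set (KobayashiSpace M)) := by
  have hK' : IsCompact (Subtype.val ⁻¹' K : Set M) := by
    rwa [Subtype.isCompact_iff, Subtype.image_preimage_coe, inter_eq_self_of_subset_right hKM]
  exact (homeomorph hM hbdd).symm.isCompact_preimage.2 hK'

end KobayashiSpace

variable [IsDiscChainConnected M]

theorem IsGeodesic.isKobayashiGeodesic {γ : ℝ → KobayashiSpace M} (h : IsGeodesic γ a b) :
    IsKobayashiGeodesic M (fun t => (γ t).val) a b :=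
  ⟨h.le, fun t _ => (γ t).mem, h.dist_eq⟩

theorem IsKobayashiGeodesic.isGeodesic {τ : ℝ → KobayashiSpace M} (h : IsKobayashiGeodesic M σ a b)
    (hτ : ∀ t ∈ Icc a b, (τ t).val = σ t) : IsGeodesic τ a b where
  le := h.1
  dist_eq s hs t ht := by
    rw [KobayashiSpace.dist_def, hτ s hs, hτ t ht, h.2.2 s hs t ht]

theorem IsAlmostGeodesic.isQuasigeodesic {τ : ℝ → KobayashiSpace M}
    (h : IsAlmostGeodesic M lam kap σ a b) (hτ : ∀ t ∈ Icc a b, (τ t).val = σ t) :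
    IsQuasigeodesic lam kap τ a b where
  le := h.1
  le_dist s hs t ht := by
    rw [KobayashiSpace.dist_def, hτ s hs, hτ t ht]
    exact (h.2.2.1 t ht s hs).1
  dist_le s hs t ht := by
    rw [KobayashiSpace.dist_def, hτ s hs, hτ t ht]
    exact (h.2.2.1 t ht s hs).2

theorem IsKobayashiGromovHyperbolic.exists_hasThinTriangles (hM : IsKobayashiGromovHyperbolic M) :
    ∃ δ, HasThinTriangles (KobayashiSpace M) δ := by
  obtain ⟨δ, hδ⟩ := hM
  refine ⟨δ, ?_⟩
  rintro x y z _ _ _ ⟨γ₁, a₁, b₁, h₁, hx, hy, rfl⟩ ⟨γ₂, a₂, b₂, h₂, hy', hz, rfl⟩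
    ⟨γ₃, a₃, b₃, h₃, hz', hx', rfl⟩ _ ⟨t, ht, rfl⟩
  rcases hδ _ _ _ a₁ b₁ a₂ b₂ a₃ b₃ h₁.isKobayashiGeodesic h₂.isKobayashiGeodesic
    h₃.isKobayashiGeodesic (congrArg _ (hy.trans hy'.symm)) (congrArg _ (hz.trans hz'.symm))
    (congrArg _ (hx'.trans hx.symm)) t ht with ⟨s, hs, h⟩ | ⟨s, hs, h⟩
  · exact ⟨γ₂ s, Or.inl ⟨s, hs, rfl⟩, h⟩
  · exact ⟨γ₃ s, Or.inr ⟨s, hs, rfl⟩, h⟩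

/-- The compact set of the first class, enlarged by `R`, serves the second class. -/
theorem HasVisibility.of_near [ProperSpace (KobayashiSpace M)]
    (hM : IsEmbeddedComplexSubmanifold M) (hbdd : Bornology.IsBounded M)
    {C C' : (ℝ → CSpace d) → ℝ → ℝ → Prop} (h : HasVisibility M C) (R : ℝ)
    (hnear : ∀ σ a b, C' σ a b → σ a ≠ σ b → ∃ τ a' b', C τ a' b' ∧ τ a' = σ a ∧ τ b' = σ b ∧
      ∀ t ∈ Icc a' b', ∃ x : KobayashiSpace M, x.val = τ t ∧
        ∃ s ∈ Icc a b, ∃ y : KobayashiSpace M, y.val = σ s ∧ dist x y ≤ R) :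
    HasVisibility M C' := by
  intro p hp q hq hpq
  obtain ⟨V, hV, W, hW, K, hVW, hKM, hK, hvis⟩ := h p hp q hq hpq
  have hK' := (KobayashiSpace.isCompact_val_preimage hM hbdd hKM hK).cthickening (r := R)
  refine ⟨V, hV, W, hW, _, hVW, image_subset_iff.2 fun x _ => x.mem,
    hK'.image (KobayashiSpace.lipschitzWith_val hbdd).continuous, fun σ a b hσ ha hb => ?_⟩
  have hne : σ a ≠ σ b := fun heq =>
    (disjoint_iff_inter_eq_empty.2 hVW).ne_of_mem (subset_closure ha) (subset_closure hb) heq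
  obtain ⟨τ, a', b', hτ, hτa, hτb, hnear⟩ := hnear σ a b hσ hne
  obtain ⟨t, ht, htK⟩ := hvis τ a' b' hτ (hτa ▸ ha) (hτb ▸ hb)
  obtain ⟨x, hx, s, hs, y, hy, hxy⟩ := hnear t ht
  refine ⟨s, hs, y, Metric.mem_cthickening_of_dist_le y x R _ ?_ (dist_comm x y ▸ hxy), hy⟩
  rwa [mem_preimage, hx]

theorem IsAlmostGeodesicVisibility.hasVisibility_isKobayashiGeodesic
    [ProperSpace (KobayashiSpace M)] (hM : IsEmbeddedComplexSubmanifold M)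
    (hbdd : Bornology.IsBounded M) {δ : ℝ}
    (hthin : HasThinTriangles (KobayashiSpace M) δ) (hgeo : IsGeodesicSpace (KobayashiSpace M))
    (h : IsAlmostGeodesicVisibility M 1 kap) : HasVisibility M (IsKobayashiGeodesic M) := by
  obtain ⟨hjoin, hvis⟩ := h
  refine hvis.of_near hM hbdd (3 * δ + 3 * kap) fun γ a b hγ hne => ?_
  obtain ⟨σ, a', b', hσ, hσa, hσb⟩ :=
    hjoin _ (hγ.2.1 (left_mem_Icc.2 hγ.1)) _ (hγ.2.1 (right_mem_Icc.2 hγ.1)) hne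
  obtain ⟨γ', hγ'⟩ := KobayashiSpace.exists_forall_val_eq hγ.1 hγ.2.1
  obtain ⟨σ', hσ'⟩ := KobayashiSpace.exists_forall_val_eq hσ.1 hσ.2.1
  have hstart : γ' a = σ' a' := KobayashiSpace.ext <| by
    rw [hγ' _ (left_mem_Icc.2 hγ.1), hσ' _ (left_mem_Icc.2 hσ.1), hσa]
  have hend : γ' b = σ' b' := KobayashiSpace.ext <| by
    rw [hγ' _ (right_mem_Icc.2 hγ.1), hσ' _ (right_mem_Icc.2 hσ.1), hσb]
  refine ⟨σ, a', b', hσ, hσa, hσb, fun t ht => ?_⟩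
  obtain ⟨_, ⟨s, hs, rfl⟩, hdist⟩ := hthin.exists_near_of_dist_add_dist_le hgeo
    ⟨γ', a, b, hγ.isGeodesic hγ', hstart, hend, rfl⟩
    ((hσ.isQuasigeodesic hσ').dist_add_dist_le ht)
  exact ⟨σ' t, hσ' t ht, s, hs, γ' s, hγ' s hs, hdist⟩

theorem HasVisibility.isAlmostGeodesic [ProperSpace (KobayashiSpace M)]
    (hM : IsEmbeddedComplexSubmanifold M) (hbdd : Bornology.IsBounded M) {δ : ℝ}
    (hthin : HasThinTriangles (KobayashiSpace M) δ) (hgeo : IsGeodesicSpace (KobayashiSpace M))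
    (hlam : 0 < lam) (h : HasVisibility M (IsKobayashiGeodesic M)) :
    HasVisibility M (IsAlmostGeodesic M lam kap) := by
  obtain ⟨R, hR⟩ := hthin.exists_quasigeodesic_near hgeo hlam kap
  refine h.of_near hM hbdd R fun σ a b hσ _ => ?_
  obtain ⟨σ', hσ'⟩ := KobayashiSpace.exists_forall_val_eq hσ.1 hσ.2.1
  obtain ⟨_, γ, a', b', hγ, hγa, hγb, rfl⟩ := hgeo (σ' a) (σ' b)
  refine ⟨_, a', b', hγ.isKobayashiGeodesic, ?_, ?_, fun t ht => ?_⟩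
  · rw [hγa, hσ' _ (left_mem_Icc.2 hσ.1)]
  · rw [hγb, hσ' _ (right_mem_Icc.2 hσ.1)]
  · obtain ⟨s, hs, hdist⟩ := hR σ' a b (hσ.isQuasigeodesic hσ') _
      ⟨γ, a', b', hγ, hγa, hγb, rfl⟩ (γ t) (mem_image_of_mem γ ht)
    exact ⟨γ t, rfl, s, hs, σ' s, hσ' s hs, hdist⟩

theorem exists_isAlmostGeodesic (hbdd : Bornology.IsBounded M) (hlam : 1 ≤ lam) (hkap : 0 < kap)
    {x y : CSpace d} (hx : x ∈ M) (hy : y ∈ M) :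
    ∃ (σ : ℝ → CSpace d) (a b : ℝ), IsAlmostGeodesic M lam kap σ a b ∧ σ a = x ∧ σ b = y := by
  obtain ⟨σ, l, hl, hσ, hσ0, hσl⟩ :=
    KobayashiSpace.exists_isSubunitCurve (⟨x, hx⟩ : KobayashiSpace M) ⟨y, hy⟩ hkap
  refine ⟨_, 0, l, hσ.isAlmostGeodesic hbdd ?_ hlam hkap.le, ?_, ?_⟩
  · rwa [hσ0, hσl, sub_zero]
  · rw [hσ0]
  · rw [hσl]

end Visibility

theorem mainTheorem10 (d : ℕ) (M : Set (CSpace d)) (hsub : IsEmbeddedComplexSubmanifold M)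
    (hconn : IsConnected M) (hbdd : Bornology.IsBounded M) (hcomplete : IsKobayashiComplete M)
    (hhyp : IsKobayashiGromovHyperbolic M) :
    IsBZVisibility M ↔ IsBNTVisibility M := by
  have := hsub.isDiscChainConnected hconn.isPreconnected
  have := Fact.mk hbdd
  have := KobayashiSpace.completeSpace hcomplete
  have := KobayashiSpace.locallyCompactSpace hsub hbdd
  have := (KobayashiSpace.isLengthSpace (M := M)).properSpace
  have hgeo := (KobayashiSpace.isLengthSpace (M := M)).isGeodesicSpace
  obtain ⟨δ, hthin⟩ := hhyp.exists_hasThinTriangles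
  constructor
  · intro hBZ
    have hvis := hBZ 1 1 le_rfl one_pos
    exact ⟨hcomplete, hvis.hasVisibility_isKobayashiGeodesic hsub hbdd hthin hgeo⟩
  · rintro ⟨-, hvis⟩ lam kap hlam hkap
    exact ⟨fun x hx y hy _ => exists_isAlmostGeodesic hbdd hlam hkap hx hy,
      hvis.isAlmostGeodesic hsub hbdd hthin hgeo (one_pos.trans_le hlam)⟩
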